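/- Let $K$ be a field. A graded filtered Floer–Novikov complex over $K$ consists of the following data. 1. A principal $\Gamma$-bundle $\pi\colon P\to S$, where $\Gamma$ is a finitely generated abelian group (written multiplicatively) and $S$ is a finite set; that is, $\Gamma$ acts freely on the set $P$, and $\pi$ is a surjection whose fibres are the $\Gamma$-orbits. 2. A function $\mathcal A\colon P\to\mathbb R$ and a homomorphism $\omega\colon\Gamma\to\mathbb R$ with $\mathcal A(g\cdot p)=\mathcal A(p)-\omega(g)$, and a function $\mathrm{gr}\colon P\to\mathbb Z$ and a homomorphism $\deg\colon\Gamma\to\mathbb Z$ with $\mathrm{gr}(g\cdot p)=\mathrm{gr}(p)-\deg(g)$. Let $$C_k=\Big\{\sum_{\mathrm{gr}(p)=k}a_pp \;\Big|\; a_p\in K,\ \#\{p: a_p\ne0,\ \mathcal A(p)>C\}<\infty\ \text{for all } C\in\mathbb R\Big\},\qquad C_*=\bigoplus_{k\in\mathbb Z}C_k,$$ and $\ell\big(\sum a_pp\big)=\max\{\mathcal A(p): a_p\neq0\}$, with $\ell(0)=-\infty$. Let $\bar\Lambda$ be the Novikov ring of formal sums $\sum_{g\in\Gamma}b_gg$ with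 $b_g\in K$, such that $\deg$ takes only finitely many values on $\{g : b_g\ne0\}$ and $\#\{g: b_g\neq0,\ \omega(g)<C\}<\infty$ for all $C\in\mathbb R$. It acts on $C_*$ by extension of the $\Gamma$-action on $P$. 3. A $\bar\Lambda$-module endomorphism $\partial\colon C_*\to C_*$ with $\partial^2=0$, $\partial(C_k)\subset C_{k-1}$ for all $k$, and $\ell(\partial c)<\ell(c)$ for all $c\neq0$. Write $\partial p=\sum_q n(p,q)q$ for $p\in P$. The opposite complex is the graded filtered Floer–Novikov complex with the same $\pi\colon P\to S$, the inverse action $g\cdot^{op}p=g^{-1}\cdot p$, the functions $-\mathcal A$ and $-\mathrm{gr}$, the same $\omega$ and $\deg$, and the boundary operator $\delta$ given by $\delta p=\sum_q n(q,p)q$, that is, $\delta\big(\sum_p d_pp\big)=\sum_q\big(\sum_p d_p\,n(q,p)\big)q$. Let $D_*$ be its chain complex and $\ell^{op}$ the corresponding function on $D_*$. The pairing $$\Delta\colon D_*\times C_*\to K,\qquad \Delta\Big(\sum_p d_pp,\sum_q c_qq\Big)=\sum_{p\in P}d_pc_p$$ satisfies $\Delta(\delta d,c)=\Delta(d,\partial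 c)$. For $\alpha\in\mathbb R$ it vanishes on $D_*^{(-\infty,-\alpha)}\times C_*^{(-\infty,\alpha]}$, where $D_*^{(-\infty,-\alpha)}=\{d\in D_* : \ell^{op}(d)<-\alpha\}$ and $C_*^{(-\infty,\alpha]}=\{c\in C_* : \ell(c)\le\alpha\}$ are subcomplexes. Hence, with $C_*^{(\alpha,\infty)}=C_*/C_*^{(-\infty,\alpha]}$, it induces for every $k\in\mathbb Z$ a $K$-bilinear pairing $$\underline\Delta_\alpha\colon H_{-k}\big(D_*^{(-\infty,-\alpha)}\big)\times H_k\big(C_*^{(\alpha,\infty)}\big)\to K.$$ **Theorem.** Suppose that $\omega$ is injective on $\Gamma_0=\ker(\deg)$. Then for all $\alpha\in\mathbb R$ and $k\in\mathbb Z$ the pairing $\underline\Delta_\alpha$ is nondegenerate: for every nonzero $b\in H_{-k}(D_*^{(-\infty,-\alpha)})$ there is $a\in H_k(C_*^{(\alpha,\infty)})$ with $\underline\Delta_\alpha(b,a)\ne0$, and for every nonzero $a\in H_k(C_*^{(\alpha,\infty)})$ there is $b\in H_{-k}(D_*^{(-\infty,-\alpha)})$ with $\underline\Delta_\alpha(b,a)\neq0$.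 -/

import Mathlib

/-- The combinatorial part of a graded filtered Floer--Novikov complex: a principal `Γ`-bundle
`proj : P → S` (with `Γ` a finitely generated abelian group, written multiplicatively, and `S` a
finite set), the action functional, the period homomorphism `ω : Γ → ℝ`, the grading and the degree
homomorphism `deg : Γ → ℤ`.  The `Γ`-action is a field because the opposite complex carries another
action of `Γ` on the same set `P`. -/
structure FloerNovikovData (Γ P S : Type*) [CommGroup Γ] where
  fg : Group.FG Γ
  finite_base : Finite S
  act : Γ → P → P
  one_act : ∀ p, act 1 p = p
  mul_act : ∀ g h p, act (g * h) p = act g (act h p)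
  free : ∀ g p, act g p = p → g = 1
  proj : P → S
  proj_surjective : Function.Surjective proj
  proj_eq_iff : ∀ p q, proj p = proj q ↔ ∃ g, act g p = q
  action : P → ℝ
  period : Γ → ℝ
  period_mul : ∀ g h, period (g * h) = period g + period h
  action_act : ∀ g p, action (act g p) = action p - period g
  gr : P → ℤ
  deg : Γ → ℤ
  deg_mul : ∀ g h, deg (g * h) = deg g + deg h
  gr_act : ∀ g p, gr (act g p) = gr p - deg g

namespace FloerNovikovData

variable {Γ P S : Type*} [CommGroup Γ] (X : FloerNovikovData Γ P S)

theorem exists_of_finsum {ι K : Type*} [Field K] {f : ι → K} (h : ∑ᶠ i, f i ≠ 0) :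
    ∃ i, f i ≠ 0 := by
  by_contra! h'
  exact h ((finsum_congr h').trans finsum_zero)

theorem period_one : X.period 1 = 0 := by
  have := X.period_mul 1 1
  simp only [mul_one] at this
  linarith

theorem period_inv (g : Γ) : X.period g⁻¹ = - X.period g := by
  have := X.period_mul g g⁻¹
  rw [mul_inv_cancel, X.period_one] at this
  linarith

theorem deg_one : X.deg 1 = 0 := by
  have := X.deg_mul 1 1
  simp only [mul_one] at this
  linarith

theorem deg_inv (g : Γ) : X.deg g⁻¹ = - X.deg g := by
  have := X.deg_mul g g⁻¹
  rw [mul_inv_cancel, X.deg_one] at this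
  linarith

theorem act_inv_act (g : Γ) (p : P) : X.act g⁻¹ (X.act g p) = p := by
  rw [← X.mul_act, inv_mul_cancel, X.one_act]

theorem act_act_inv (g : Γ) (p : P) : X.act g (X.act g⁻¹ p) = p := by
  rw [← X.mul_act, mul_inv_cancel, X.one_act]

theorem act_left_injective (p : P) : Function.Injective (fun g => X.act g p) := by
  intro g h hgh
  have hgh' : X.act g p = X.act h p := hgh
  have : X.act (h⁻¹ * g) p = p := by rw [X.mul_act, hgh', X.act_inv_act]
  have h1 := X.free _ _ this
  exact (inv_mul_eq_one.mp h1).symm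

section Chains

variable (K : Type*) [Field K]

/-- The full Floer chain complex `C_* = ⨁ₖ Cₖ`, as a `K`-vector space.  An element is a formal sum
`∑ c_p p`, i.e. a function `c : P → K`, involving finitely many gradings and such that for each
real `C` only finitely many `p` with `c_p ≠ 0` have action `> C`. -/
def chains : Submodule K (P → K) where
  carrier := {c | (X.gr '' {p | c p ≠ 0}).Finite ∧ ∀ C : ℝ, {p | c p ≠ 0 ∧ C < X.action p}.Finite}
  zero_mem' := by simp
  add_mem' := by
    rintro a b ⟨ha, ha'⟩ ⟨hb, hb'⟩
    have key : ∀ p, (a + b) p ≠ 0 → a p ≠ 0 ∨ b p ≠ 0 := by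
      intro p hp
      by_contra! h
      exact hp (by simp [h.1, h.2])
    refine ⟨(ha.union hb).subset ?_, fun C => ((ha' C).union (hb' C)).subset ?_⟩
    · rintro _ ⟨p, hp, rfl⟩
      rcases key p hp with h | h
      · exact Or.inl ⟨p, h, rfl⟩
      · exact Or.inr ⟨p, h, rfl⟩
    · rintro p ⟨hp, hC⟩
      rcases key p hp with h | h
      · exact Or.inl ⟨h, hC⟩
      · exact Or.inr ⟨h, hC⟩
  smul_mem' := by
    rintro r a ⟨ha, ha'⟩
    have key : ∀ p, (r • a) p ≠ 0 → a p ≠ 0 := by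
      intro p hp h
      exact hp (by simp [h])
    refine ⟨ha.subset ?_, fun C => (ha' C).subset ?_⟩
    · rintro _ ⟨p, hp, rfl⟩
      exact ⟨p, key p hp, rfl⟩
    · rintro p ⟨hp, hC⟩
      exact ⟨key p hp, hC⟩

/-- The degree-`k` part `Cₖ`: formal sums of generators of grading `k`. -/
def graded (k : ℤ) : Submodule K (X.chains K) where
  carrier := {c | ∀ p, c.1 p ≠ 0 → X.gr p = k}
  zero_mem' := by simp
  add_mem' := by
    intro a b ha hb p hp
    by_cases h : a.1 p = 0
    · refine hb p fun h' => hp ?_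
      simp [h, h']
    · exact ha p h
  smul_mem' := by
    intro r a ha p hp
    exact ha p fun h => hp (by simp [h])

/-- The full Novikov ring `⨁ₙ eⁿ Λ`, as a `K`-vector space: formal sums `∑ a_g g` over `Γ` involving
finitely many degrees such that for each real `C` only finitely many `g` with `a_g ≠ 0` have period
`< C`. -/
def novikov : Submodule K (Γ → K) where
  carrier := {a | (X.deg '' {g | a g ≠ 0}).Finite ∧ ∀ C : ℝ, {g | a g ≠ 0 ∧ X.period g < C}.Finite}
  zero_mem' := by simp
  add_mem' := by
    rintro a b ⟨ha, ha'⟩ ⟨hb, hb'⟩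
    have key : ∀ p, (a + b) p ≠ 0 → a p ≠ 0 ∨ b p ≠ 0 := by
      intro p hp
      by_contra! h
      exact hp (by simp [h.1, h.2])
    refine ⟨(ha.union hb).subset ?_, fun C => ((ha' C).union (hb' C)).subset ?_⟩
    · rintro _ ⟨p, hp, rfl⟩
      rcases key p hp with h | h
      · exact Or.inl ⟨p, h, rfl⟩
      · exact Or.inr ⟨p, h, rfl⟩
    · rintro p ⟨hp, hC⟩
      rcases key p hp with h | h
      · exact Or.inl ⟨h, hC⟩
      · exact Or.inr ⟨h, hC⟩
  smul_mem' := by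
    rintro r a ⟨ha, ha'⟩
    have key : ∀ p, (r • a) p ≠ 0 → a p ≠ 0 := by
      intro p hp h
      exact hp (by simp [h])
    refine ⟨ha.subset ?_, fun C => (ha' C).subset ?_⟩
    · rintro _ ⟨p, hp, rfl⟩
      exact ⟨p, key p hp, rfl⟩
    · rintro p ⟨hp, hC⟩
      exact ⟨key p hp, hC⟩

variable {K}

theorem chains_bdd (c : X.chains K) : ∃ M : ℝ, ∀ p, c.1 p ≠ 0 → X.action p ≤ M := by
  obtain ⟨M, hM⟩ := ((c.2.2 0).image X.action).bddAbove
  refine ⟨max M 0, fun p hp => ?_⟩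
  by_cases h : 0 < X.action p
  · exact le_max_of_le_left (hM ⟨p, ⟨hp, h⟩, rfl⟩)
  · exact le_max_of_le_right (not_lt.mp h)

theorem novikov_bdd (a : X.novikov K) : ∃ m : ℝ, ∀ g, a.1 g ≠ 0 → m ≤ X.period g := by
  obtain ⟨M, hM⟩ := ((a.2.2 0).image X.period).bddBelow
  refine ⟨min M 0, fun p hp => ?_⟩
  by_cases h : X.period p < 0
  · exact min_le_of_left_le (hM ⟨p, ⟨hp, h⟩, rfl⟩)
  · exact min_le_of_right_le (not_lt.mp h)

theorem novikov_conv_finite (a : X.novikov K) (c : X.chains K) (C : ℝ) :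
    {x : Γ × P | a.1 x.1 ≠ 0 ∧ c.1 x.2 ≠ 0 ∧ C < X.action x.2 - X.period x.1}.Finite := by
  obtain ⟨M, hM⟩ := X.chains_bdd c
  obtain ⟨m, hm⟩ := X.novikov_bdd a
  refine ((a.2.2 (M - C)).prod (c.2.2 (C + m))).subset ?_
  rintro ⟨g, p⟩ ⟨h1, h2, h3⟩
  have := hM p h2
  have := hm g h1
  simp only at h3
  exact ⟨⟨h1, by linarith⟩, ⟨h2, by linarith⟩⟩

/-- The action of the Novikov ring on the Floer complex, which extends the `Γ`-action on `P`:
the coefficient of `p` in `(∑ a_g g) (∑ c_q q)` is the (finite) sum of the `a_g c_q` with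
`g q = p`. -/
noncomputable def novikovAct (a : X.novikov K) (c : X.chains K) : X.chains K :=
  ⟨fun p => ∑ᶠ g, a.1 g * c.1 (X.act g⁻¹ p), by
    have key : ∀ p, (∑ᶠ g, a.1 g * c.1 (X.act g⁻¹ p)) ≠ 0 →
        ∃ g q, a.1 g ≠ 0 ∧ c.1 q ≠ 0 ∧ X.act g q = p := by
      intro p hp
      obtain ⟨g, hg⟩ := FloerNovikovData.exists_of_finsum hp
      exact ⟨g, _, left_ne_zero_of_mul hg, right_ne_zero_of_mul hg, X.act_act_inv g p⟩
    refine ⟨((a.2.1.prod c.2.1).image (fun x => x.2 - x.1)).subset ?_, fun C =>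
      ((X.novikov_conv_finite a c C).image (fun x => X.act x.1 x.2)).subset ?_⟩
    · rintro _ ⟨p, hp, rfl⟩
      obtain ⟨g, q, hg, hq, rfl⟩ := key p hp
      exact ⟨(X.deg g, X.gr q), ⟨⟨g, hg, rfl⟩, ⟨q, hq, rfl⟩⟩, (X.gr_act g q).symm⟩
    · rintro p ⟨hp, hC⟩
      obtain ⟨g, q, hg, hq, rfl⟩ := key p hp
      exact ⟨(g, q), ⟨hg, hq, by rw [X.action_act] at hC; exact hC⟩, rfl⟩⟩

/-- `ℓ(∑ c_p p) = max {𝒜(p) | c_p ≠ 0}`, with `ℓ(0) = -∞`. -/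
noncomputable def level (c : X.chains K) : EReal :=
  sSup ((fun p => (X.action p : EReal)) '' {p | c.1 p ≠ 0})

theorem level_zero : X.level (0 : X.chains K) = ⊥ := by
  simp [level]

theorem exists_level_eq {c : X.chains K} (hc : c ≠ 0) :
    ∃ p, c.1 p ≠ 0 ∧ (∀ q, c.1 q ≠ 0 → X.action q ≤ X.action p) ∧ X.level c = X.action p := by
  have : ∃ p, c.1 p ≠ 0 := by
    by_contra! h
    exact hc (Subtype.ext (funext h))
  obtain ⟨p₀, hp₀⟩ := this
  obtain ⟨p, ⟨hp, hp1⟩, hmax⟩ := Set.exists_max_image _ X.action (c.2.2 (X.action p₀ - 1))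
    ⟨p₀, hp₀, by linarith⟩
  have hall : ∀ q, c.1 q ≠ 0 → X.action q ≤ X.action p := by
    intro q hq
    by_cases h : X.action p₀ - 1 < X.action q
    · exact hmax q ⟨hq, h⟩
    · linarith
  refine ⟨p, hp, hall, le_antisymm (sSup_le ?_) (le_sSup ⟨p, hp, rfl⟩)⟩
  rintro _ ⟨q, hq, rfl⟩
  exact EReal.coe_le_coe_iff.mpr (hall q hq)

theorem action_le_level {c : X.chains K} {p : P} (hp : c.1 p ≠ 0) :
    (X.action p : EReal) ≤ X.level c :=
  le_sSup ⟨p, hp, rfl⟩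

theorem level_lt_iff (c : X.chains K) (α : ℝ) :
    X.level c < α ↔ ∀ p, c.1 p ≠ 0 → X.action p < α := by
  constructor
  · intro h p hp
    exact EReal.coe_lt_coe_iff.mp (lt_of_le_of_lt (X.action_le_level hp) h)
  · intro h
    by_cases hc : c = 0
    · rw [hc, level_zero]
      exact EReal.bot_lt_coe α
    · obtain ⟨p, hp, -, hl⟩ := X.exists_level_eq hc
      rw [hl]
      exact EReal.coe_lt_coe_iff.mpr (h p hp)

theorem level_le_iff (c : X.chains K) (α : ℝ) :
    X.level c ≤ α ↔ ∀ p, c.1 p ≠ 0 → X.action p ≤ α := by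
  constructor
  · intro h p hp
    exact EReal.coe_le_coe_iff.mp ((X.action_le_level hp).trans h)
  · intro h
    refine sSup_le ?_
    rintro _ ⟨q, hq, rfl⟩
    exact EReal.coe_le_coe_iff.mpr (h q hq)

variable (K)

/-- `C_*^{(-∞,α)} = {c | ℓ(c) < α}`. -/
def filtLT (α : ℝ) : Submodule K (X.chains K) where
  carrier := {c | X.level c < α}
  zero_mem' := by
    change X.level 0 < _
    rw [level_zero]
    exact EReal.bot_lt_coe α
  add_mem' := by
    intro a b ha hb
    refine (X.level_lt_iff _ α).mpr fun p hp => ?_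
    by_cases h : a.1 p = 0
    · refine (X.level_lt_iff b α).mp hb p fun h' => hp ?_
      simp [h, h']
    · exact (X.level_lt_iff a α).mp ha p h
  smul_mem' := by
    intro r a ha
    refine (X.level_lt_iff _ α).mpr fun p hp => ?_
    exact (X.level_lt_iff a α).mp ha p fun h => hp (by simp [h])

/-- `C_*^{(-∞,α]} = {c | ℓ(c) ≤ α}`. -/
def filtLE (α : ℝ) : Submodule K (X.chains K) where
  carrier := {c | X.level c ≤ α}
  zero_mem' := by
    change X.level 0 ≤ _
    rw [level_zero]
    exact bot_le
  add_mem' := by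
    intro a b ha hb
    refine (X.level_le_iff _ α).mpr fun p hp => ?_
    by_cases h : a.1 p = 0
    · refine (X.level_le_iff b α).mp hb p fun h' => hp ?_
      simp [h, h']
    · exact (X.level_le_iff a α).mp ha p h
  smul_mem' := by
    intro r a ha
    refine (X.level_le_iff _ α).mpr fun p hp => ?_
    exact (X.level_le_iff a α).mp ha p fun h => hp (by simp [h])

open Classical in
/-- A point `p` of `P`, regarded as an element of `C_*`. -/
noncomputable def gen (p : P) : X.chains K :=
  ⟨Pi.single p 1, by
    have key : ∀ q, (Pi.single p 1 : P → K) q ≠ 0 → q = p := by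
      intro q hq
      by_contra h
      exact hq (Pi.single_eq_of_ne h 1)
    refine ⟨(Set.finite_singleton (X.gr p)).subset ?_,
      fun C => (Set.finite_singleton p).subset fun q hq => key q hq.1⟩
    rintro _ ⟨q, hq, rfl⟩
    rw [key q hq]
    rfl⟩

end Chains

/-- The data of the opposite complex: `Γ` acts through inverses, the action functional and the
grading are negated, the period and degree homomorphisms are unchanged. -/
def op : FloerNovikovData Γ P S where
  fg := X.fg
  finite_base := X.finite_base
  act g p := X.act g⁻¹ p
  one_act p := by rw [inv_one, X.one_act]
  mul_act g h p := by rw [mul_inv, X.mul_act]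
  free g p h := inv_eq_one.mp (X.free _ _ h)
  proj := X.proj
  proj_surjective := X.proj_surjective
  proj_eq_iff p q := by
    rw [X.proj_eq_iff]
    exact ⟨fun ⟨g, hg⟩ => ⟨g⁻¹, by rwa [inv_inv]⟩, fun ⟨g, hg⟩ => ⟨g⁻¹, hg⟩⟩
  action p := - X.action p
  period := X.period
  period_mul := X.period_mul
  action_act g p := by rw [X.action_act, X.period_inv]; ring
  gr p := - X.gr p
  deg := X.deg
  deg_mul := X.deg_mul
  gr_act g p := by rw [X.gr_act, X.deg_inv]; ring

theorem op_finite {K : Type*} [Field K] (d : X.op.chains K) (C : ℝ) :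
    {p | d.1 p ≠ 0 ∧ X.action p < C}.Finite := by
  refine (d.2.2 (-C)).subset ?_
  rintro p ⟨h1, h2⟩
  exact ⟨h1, neg_lt_neg h2⟩

theorem op_bdd {K : Type*} [Field K] (d : X.op.chains K) :
    ∃ m : ℝ, ∀ p, d.1 p ≠ 0 → m ≤ X.action p := by
  obtain ⟨M, hM⟩ := X.op.chains_bdd d
  exact ⟨-M, fun p hp => neg_le.mp (hM p hp)⟩

theorem pairing_finite {K : Type*} [Field K] (d : X.op.chains K) (c : X.chains K) :
    (Function.support fun p => d.1 p * c.1 p).Finite := by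
  obtain ⟨m, hm⟩ := X.op_bdd d
  refine (c.2.2 (m - 1)).subset ?_
  intro p hp
  have := hm p (left_ne_zero_of_mul hp)
  exact ⟨right_ne_zero_of_mul hp, by linarith⟩

/-- The pairing `Δ : D_* × C_* → K`, `Δ(∑ d_p p, ∑ c_q q) = ∑ d_p c_p` (a finite sum). -/
noncomputable def pairing (K : Type*) [Field K] : X.op.chains K →ₗ[K] X.chains K →ₗ[K] K :=
  LinearMap.mk₂ K (fun d c => ∑ᶠ p, d.1 p * c.1 p)
    (by
      intro d d' c
      rw [← finsum_add_distrib (X.pairing_finite d c) (X.pairing_finite d' c)]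
      exact finsum_congr fun p => add_mul _ _ _)
    (by
      intro r d c
      rw [smul_eq_mul, mul_finsum]
      exact finsum_congr fun p => mul_assoc _ _ _)
    (by
      intro d c c'
      rw [← finsum_add_distrib (X.pairing_finite d c) (X.pairing_finite d c')]
      exact finsum_congr fun p => mul_add _ _ _)
    (by
      intro r d c
      rw [smul_eq_mul, mul_finsum]
      exact finsum_congr fun p => mul_left_comm _ _ _)

theorem pairing_apply {K : Type*} [Field K] (d : X.op.chains K) (c : X.chains K) :
    X.pairing K d c = ∑ᶠ p, d.1 p * c.1 p := rfl

/-- `Δ` vanishes on `D_*^{(-∞,-α)} × C_*^{(-∞,α]}`. -/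
theorem pairing_filt {K : Type*} [Field K] (α : ℝ) {d : X.op.chains K} {c : X.chains K}
    (hd : d ∈ X.op.filtLT K (-α)) (hc : c ∈ X.filtLE K α) : X.pairing K d c = 0 := by
  rw [pairing_apply]
  refine (finsum_congr fun p => ?_).trans finsum_zero
  by_contra h
  have h1 : -X.action p < -α := (X.op.level_lt_iff d (-α)).mp hd p (left_ne_zero_of_mul h)
  have h2 := (X.level_le_iff c α).mp hc p (right_ne_zero_of_mul h)
  linarith

theorem finsum_swap {α β K : Type*} [Field K] (f : α → β → K)
    (h : {x : α × β | f x.1 x.2 ≠ 0}.Finite) :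
    ∑ᶠ a, ∑ᶠ b, f a b = ∑ᶠ b, ∑ᶠ a, f a b := by
  have h' : {x : β × α | f x.2 x.1 ≠ 0}.Finite := by
    refine (h.image Prod.swap).subset ?_
    rintro ⟨b, a⟩ hx
    exact ⟨(a, b), hx, rfl⟩
  rw [← finsum_curry (fun x : α × β => f x.1 x.2) h,
    ← finsum_curry (fun x : β × α => f x.2 x.1) h']
  exact (finsum_comp_equiv (Equiv.prodComm β α) (f := fun x : α × β => f x.1 x.2)).symm

end FloerNovikovData

/-- A graded filtered Floer--Novikov complex over the field `K`.  The boundary operator is an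
endomorphism of the Floer complex as a module over the full Novikov ring. -/
structure FloerNovikovComplex (K Γ P S : Type*) [Field K] [CommGroup Γ] extends
    FloerNovikovData Γ P S where
  bd : toFloerNovikovData.chains K →ₗ[K] toFloerNovikovData.chains K
  bd_novikovAct : ∀ (a : toFloerNovikovData.novikov K) (c : toFloerNovikovData.chains K),
    bd (toFloerNovikovData.novikovAct a c) = toFloerNovikovData.novikovAct a (bd c)
  bd_bd : ∀ c, bd (bd c) = 0
  level_bd : ∀ c, c ≠ 0 → toFloerNovikovData.level (bd c) < toFloerNovikovData.level c
  bd_graded : ∀ k, ∀ c ∈ toFloerNovikovData.graded K k, bd c ∈ toFloerNovikovData.graded K (k - 1)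

namespace FloerNovikovComplex

variable {K Γ P S : Type*} [Field K] [CommGroup Γ] (X : FloerNovikovComplex K Γ P S)

/-- The coefficients `n(p,q)`, where `∂p = ∑ n(p,q) q`. -/
noncomputable def coeff (p q : P) : K := (X.bd (X.gen K p)).1 q

theorem gen_self (p : P) : (X.gen K p).1 p = 1 := by
  classical
  exact Pi.single_eq_same p 1

theorem gen_ne {p q : P} (h : q ≠ p) : (X.gen K p).1 q = 0 := by
  classical
  exact Pi.single_eq_of_ne h 1

theorem gen_ne_zero (p : P) : X.gen K p ≠ 0 := by
  intro h
  have h1 := X.gen_self p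
  rw [h] at h1
  exact zero_ne_one h1

theorem action_lt_of_coeff {p q : P} (h : X.coeff p q ≠ 0) : X.action q < X.action p := by
  have h1 : X.level (X.gen K p) = X.action p := by
    obtain ⟨r, hr, -, hl⟩ := X.exists_level_eq (X.gen_ne_zero p)
    rw [hl]
    by_cases hrp : r = p
    · rw [hrp]
    · exact absurd (X.gen_ne hrp) hr
  have h2 := X.level_bd _ (X.gen_ne_zero p)
  rw [h1] at h2
  exact (X.level_lt_iff _ _).mp h2 q h

theorem gr_of_coeff {p q : P} (h : X.coeff p q ≠ 0) : X.gr q = X.gr p - 1 := by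
  refine X.bd_graded (X.gr p) (X.gen K p) ?_ q h
  intro r hr
  by_cases hrp : r = p
  · rw [hrp]
  · exact absurd (X.gen_ne hrp) hr

open Classical in
/-- A group element, regarded as an element of the Novikov ring. -/
noncomputable def novGen (g : Γ) : X.novikov K :=
  ⟨Pi.single g 1, by
    have key : ∀ q, (Pi.single g 1 : Γ → K) q ≠ 0 → q = g := by
      intro q hq
      by_contra h
      exact hq (Pi.single_eq_of_ne h 1)
    refine ⟨(Set.finite_singleton (X.deg g)).subset ?_,
      fun C => (Set.finite_singleton g).subset fun q hq => key q hq.1⟩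
    rintro _ ⟨q, hq, rfl⟩
    rw [key q hq]
    rfl⟩

theorem novGen_act (g : Γ) (c : X.chains K) (p : P) :
    (X.novikovAct (X.novGen g) c).1 p = c.1 (X.act g⁻¹ p) := by
  classical
  change ∑ᶠ h, (Pi.single g 1 : Γ → K) h * c.1 (X.act h⁻¹ p) = _
  rw [finsum_eq_single _ g]
  · rw [Pi.single_eq_same, one_mul]
  · intro h hh
    rw [Pi.single_eq_of_ne hh, zero_mul]

theorem novGen_gen (g : Γ) (p : P) :
    X.novikovAct (X.novGen g) (X.gen K p) = X.gen K (X.act g p) := by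
  refine Subtype.ext (funext fun q => ?_)
  rw [novGen_act]
  by_cases h : q = X.act g p
  · rw [h, X.act_inv_act, gen_self, gen_self]
  · rw [X.gen_ne h, X.gen_ne]
    intro h'
    exact h (by rw [← h', X.act_act_inv])

theorem coeff_act (g : Γ) (p q : P) : X.coeff (X.act g p) (X.act g q) = X.coeff p q := by
  unfold coeff
  rw [← novGen_gen, X.bd_novikovAct, novGen_act, X.act_inv_act]

theorem bd_apply_finite (c : X.chains K) (q : P) :
    (Function.support fun p => c.1 p * X.coeff p q).Finite := by
  refine (c.2.2 (X.action q)).subset ?_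
  intro p hp
  exact ⟨left_ne_zero_of_mul hp, X.action_lt_of_coeff (right_ne_zero_of_mul hp)⟩

/-- `∂(∑ c_p p) = ∑_q (∑_p c_p n(p,q)) q`. -/
theorem bd_apply (c : X.chains K) (q : P) :
    (X.bd c).1 q = ∑ᶠ p, c.1 p * X.coeff p q := by
  classical
  have := X.finite_base
  have := Fintype.ofFinite S
  choose σ hσ using X.proj_surjective
  let a : S → X.novikov K := fun s => ⟨fun g => c.1 (X.act g (σ s)), by
    refine ⟨((c.2.1).image fun k => X.gr (σ s) - k).subset ?_, fun C => ?_⟩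
    · rintro _ ⟨g, hg, rfl⟩
      refine ⟨_, ⟨_, hg, rfl⟩, ?_⟩
      simp only [X.gr_act]
      ring
    · refine ((c.2.2 (X.action (σ s) - C)).preimage
        (X.act_left_injective (σ s)).injOn).subset ?_
      rintro g ⟨h1, h2⟩
      refine ⟨h1, ?_⟩
      rw [X.action_act]
      linarith⟩
  have hproj : ∀ g p, X.proj (X.act g p) = X.proj p := fun g p =>
    ((X.proj_eq_iff p _).mpr ⟨g, rfl⟩).symm
  let e : S × Γ ≃ P := Equiv.ofBijective (fun x => X.act x.2 (σ x.1)) (by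
    constructor
    · rintro ⟨s, g⟩ ⟨t, h⟩ hx
      have hx' : X.act g (σ s) = X.act h (σ t) := hx
      have hst : s = t := by
        have := congrArg X.proj hx'
        rwa [hproj, hproj, hσ, hσ] at this
      subst hst
      rw [X.act_left_injective (σ s) hx']
    · intro p
      obtain ⟨g, hg⟩ := (X.proj_eq_iff (σ (X.proj p)) p).mp (hσ _)
      exact ⟨(X.proj p, g), hg⟩)
  have hval : ∀ s (b : X.chains K) r, (X.novikovAct (a s) b).1 r =
      ∑ᶠ g, c.1 (X.act g (σ s)) * b.1 (X.act g⁻¹ r) := fun _ _ _ => rfl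
  have hcoe : ∀ (f : S → X.chains K) r, (∑ s, f s).1 r = ∑ s, (f s).1 r := by
    intro f r
    have : (∑ s, f s).1 = ∑ s, (f s).1 := Submodule.coe_sum _ _ _
    rw [this, Finset.sum_apply]
  have hsum : ∀ F : P → K, (Function.support F).Finite →
      ∑ᶠ p, F p = ∑ s, ∑ᶠ g, F (X.act g (σ s)) := by
    intro F hF
    rw [← finsum_comp_equiv e, finsum_curry, finsum_eq_sum_of_fintype]
    · rfl
    · exact hF.preimage e.injective.injOn
  have hc : c = ∑ s, X.novikovAct (a s) (X.gen K (σ s)) := by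
    refine Subtype.ext (funext fun r => ?_)
    rw [hcoe]
    have h1 : c.1 r = ∑ᶠ p, c.1 p * (X.gen K p).1 r := by
      rw [finsum_eq_single _ r, gen_self, mul_one]
      intro p hp
      rw [X.gen_ne hp.symm, mul_zero]
    rw [h1, hsum]
    · refine Finset.sum_congr rfl fun s _ => ?_
      rw [hval]
      refine finsum_congr fun g => ?_
      rw [← novGen_gen, novGen_act]
    · refine (Set.finite_singleton r).subset ?_
      intro p hp
      by_contra h
      exact right_ne_zero_of_mul hp (X.gen_ne (Ne.symm h))
  conv_lhs => rw [hc]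
  rw [map_sum, hcoe, hsum _ (X.bd_apply_finite c q)]
  refine Finset.sum_congr rfl fun s _ => ?_
  rw [X.bd_novikovAct, hval]
  refine finsum_congr fun g => ?_
  have := X.coeff_act g (σ s) (X.act g⁻¹ q)
  rw [X.act_act_inv] at this
  rw [this]
  rfl

theorem coeff_finite (p : P) (C : ℝ) : {q | X.coeff q p ≠ 0 ∧ X.action q < C}.Finite := by
  have := X.finite_base
  choose σ hσ using X.proj_surjective
  have key : ∀ s, {g | X.coeff (X.act g (σ s)) p ≠ 0 ∧ X.action (X.act g (σ s)) < C}.Finite := by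
    intro s
    have hinj : Function.Injective fun g => X.act g⁻¹ p :=
      (X.act_left_injective p).comp inv_injective
    refine (((X.bd (X.gen K (σ s))).2.2 (X.action p + X.action (σ s) - C)).preimage
      hinj.injOn).subset ?_
    rintro g ⟨h1, h2⟩
    have h3 := X.coeff_act g (σ s) (X.act g⁻¹ p)
    rw [X.act_act_inv] at h3
    rw [h3] at h1
    refine ⟨h1, ?_⟩
    rw [X.action_act] at h2
    rw [X.action_act, X.period_inv]
    linarith
  refine (Set.finite_iUnion fun s => (key s).image fun g => X.act g (σ s)).subset ?_
  rintro q hq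
  obtain ⟨g, hg⟩ := (X.proj_eq_iff (σ (X.proj q)) q).mp (hσ _)
  refine Set.mem_iUnion.mpr ⟨X.proj q, g, ?_, hg⟩
  change X.coeff (X.act g _) p ≠ 0 ∧ X.action (X.act g _) < C
  rw [hg]
  exact hq

theorem delta_finite (d : X.op.chains K) (q : P) :
    (Function.support fun p => d.1 p * X.coeff q p).Finite :=
  X.pairing_finite d (X.bd (X.gen K q))

/-- The boundary operator of the opposite complex: `δp = ∑ n(q,p) q`, so that
`δ(∑ d_p p) = ∑_q (∑_p d_p n(q,p)) q`. -/
noncomputable def delta : X.op.chains K →ₗ[K] X.op.chains K where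
  toFun d := ⟨fun q => ∑ᶠ p, d.1 p * X.coeff q p, by
    have key : ∀ q, (∑ᶠ p, d.1 p * X.coeff q p) ≠ 0 → ∃ p, d.1 p ≠ 0 ∧ X.coeff q p ≠ 0 := by
      intro q hq
      obtain ⟨p, hp⟩ := FloerNovikovData.exists_of_finsum hq
      exact ⟨p, left_ne_zero_of_mul hp, right_ne_zero_of_mul hp⟩
    refine ⟨(d.2.1.image fun k => k - 1).subset ?_, fun C => ?_⟩
    · rintro _ ⟨q, hq, rfl⟩
      obtain ⟨p, hp, hn⟩ := key q hq
      refine ⟨_, ⟨p, hp, rfl⟩, ?_⟩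
      change - X.gr p - 1 = - X.gr q
      rw [X.gr_of_coeff hn]
      ring
    · refine ((X.op_finite d (-C)).biUnion fun p _ => X.coeff_finite p (-C)).subset ?_
      rintro q ⟨hq, hC⟩
      obtain ⟨p, hp, hn⟩ := key q hq
      have hC' : X.action q < -C := lt_neg_of_lt_neg hC
      have := X.action_lt_of_coeff hn
      exact Set.mem_biUnion (show p ∈ {p | d.1 p ≠ 0 ∧ X.action p < -C} from
        ⟨hp, this.trans hC'⟩) ⟨hn, hC'⟩⟩
  map_add' d d' := by
    refine Subtype.ext (funext fun q => ?_)
    change ∑ᶠ p, (d.1 p + d'.1 p) * X.coeff q p =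
      ∑ᶠ p, d.1 p * X.coeff q p + ∑ᶠ p, d'.1 p * X.coeff q p
    rw [← finsum_add_distrib (X.delta_finite d q) (X.delta_finite d' q)]
    exact finsum_congr fun p => add_mul _ _ _
  map_smul' r d := by
    refine Subtype.ext (funext fun q => ?_)
    change ∑ᶠ p, (r * d.1 p) * X.coeff q p = r * ∑ᶠ p, d.1 p * X.coeff q p
    rw [mul_finsum]
    exact finsum_congr fun p => mul_assoc _ _ _

theorem delta_apply (d : X.op.chains K) (q : P) :
    (X.delta d).1 q = ∑ᶠ p, d.1 p * X.coeff q p := rfl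

/-- `Δ(δd, c) = Δ(d, ∂c)`. -/
theorem pairing_delta (d : X.op.chains K) (c : X.chains K) :
    X.pairing K (X.delta d) c = X.pairing K d (X.bd c) := by
  rw [X.pairing_apply, X.pairing_apply]
  have h1 : ∀ q, (X.delta d).1 q * c.1 q = ∑ᶠ p, d.1 p * X.coeff q p * c.1 q := by
    intro q
    rw [delta_apply, finsum_mul]
  have h2 : ∀ p, d.1 p * (X.bd c).1 p = ∑ᶠ q, d.1 p * X.coeff q p * c.1 q := by
    intro p
    rw [bd_apply, mul_finsum]
    exact finsum_congr fun q => by ring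
  rw [finsum_congr h1, finsum_congr h2]
  refine FloerNovikovData.finsum_swap (fun q p => d.1 p * X.coeff q p * c.1 q) ?_
  obtain ⟨m, hm⟩ := X.op_bdd d
  obtain ⟨M, hM⟩ := X.chains_bdd c
  refine ((c.2.2 m).prod (X.op_finite d M)).subset ?_
  rintro ⟨q, p⟩ hx
  have hc : c.1 q ≠ 0 := right_ne_zero_of_mul hx
  have hd : d.1 p ≠ 0 := left_ne_zero_of_mul (left_ne_zero_of_mul hx)
  have hn := X.action_lt_of_coeff (right_ne_zero_of_mul (left_ne_zero_of_mul hx))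
  have := hm p hd
  have := hM q hc
  exact ⟨⟨hc, by simp only; linarith⟩, ⟨hd, by simp only; linarith⟩⟩

theorem delta_novikovAct (a : X.op.novikov K) (d : X.op.chains K) :
    X.delta (X.op.novikovAct a d) = X.op.novikovAct a (X.delta d) := by
  refine Subtype.ext (funext fun q => ?_)
  have hact : ∀ (b : X.op.chains K) r,
      (X.op.novikovAct a b).1 r = ∑ᶠ g, a.1 g * b.1 (X.act g r) := by
    intro b r
    refine finsum_congr fun g => ?_
    change a.1 g * b.1 (X.act g⁻¹⁻¹ r) = _
    rw [inv_inv]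
  rw [hact, delta_apply]
  have hF : {x : P × Γ | a.1 x.2 * d.1 (X.act x.2 x.1) * X.coeff q x.1 ≠ 0}.Finite := by
    have hfin := X.op.novikov_conv_finite a d (- X.action q)
    refine (hfin.image fun x => (X.act x.1⁻¹ x.2, x.1)).subset ?_
    rintro ⟨p, g⟩ hx
    have h1 : a.1 g ≠ 0 := left_ne_zero_of_mul (left_ne_zero_of_mul hx)
    have h2 : d.1 (X.act g p) ≠ 0 := right_ne_zero_of_mul (left_ne_zero_of_mul hx)
    have h3 := X.action_lt_of_coeff (right_ne_zero_of_mul hx)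
    refine ⟨(g, X.act g p), ⟨h1, h2, ?_⟩, by simp only [X.act_inv_act]⟩
    change - X.action q < - X.action (X.act g p) - X.period g
    rw [X.action_act]
    simp only at h3
    linarith
  have h1 : ∀ p, (X.op.novikovAct a d).1 p * X.coeff q p =
      ∑ᶠ g, a.1 g * d.1 (X.act g p) * X.coeff q p := by
    intro p
    rw [hact]
    rw [finsum_mul]
  rw [finsum_congr h1, FloerNovikovData.finsum_swap _ hF]
  refine finsum_congr fun g => ?_
  rw [delta_apply, mul_finsum]
  let e : P ≃ P := ⟨X.act g, X.act g⁻¹, X.act_inv_act g, X.act_act_inv g⟩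
  refine Eq.trans ?_ (finsum_comp_equiv e)
  refine finsum_congr fun p => ?_
  change _ = a.1 g * (d.1 (X.act g p) * X.coeff (X.act g q) (X.act g p))
  rw [coeff_act, mul_assoc]

theorem delta_delta (d : X.op.chains K) : X.delta (X.delta d) = 0 := by
  refine Subtype.ext (funext fun q => ?_)
  have h : (X.delta (X.delta d)).1 q = X.pairing K (X.delta d) (X.bd (X.gen K q)) := rfl
  rw [h, pairing_delta, X.bd_bd, map_zero]
  rfl

theorem exists_of_delta {d : X.op.chains K} {q : P} (h : (X.delta d).1 q ≠ 0) :
    ∃ p, d.1 p ≠ 0 ∧ X.coeff q p ≠ 0 := by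
  rw [delta_apply] at h
  obtain ⟨p, hp⟩ := FloerNovikovData.exists_of_finsum h
  exact ⟨p, left_ne_zero_of_mul hp, right_ne_zero_of_mul hp⟩

/-- The opposite complex. -/
noncomputable def op : FloerNovikovComplex K Γ P S where
  toFloerNovikovData := X.toFloerNovikovData.op
  bd := X.delta
  bd_novikovAct := X.delta_novikovAct
  bd_bd := X.delta_delta
  level_bd d hd := by
    obtain ⟨r, hr, hmax, hl⟩ := X.toFloerNovikovData.op.exists_level_eq hd
    rw [hl, FloerNovikovData.level_lt_iff]
    intro q hq
    obtain ⟨p, hp, hn⟩ := X.exists_of_delta hq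
    exact lt_of_lt_of_le (neg_lt_neg (X.action_lt_of_coeff hn)) (hmax p hp)
  bd_graded k d hd q hq := by
    obtain ⟨p, hp, hn⟩ := X.exists_of_delta hq
    have h1 : - X.gr p = k := hd p hp
    have h2 := X.gr_of_coeff hn
    change - X.gr q = k - 1
    linarith

/-- `δp = ∑ n(q,p) q`. -/
theorem op_coeff (p q : P) : X.op.coeff p q = X.coeff q p := by
  change ∑ᶠ r, (X.op.gen K p).1 r * X.coeff q r = _
  rw [finsum_eq_single _ p, X.op.gen_self, one_mul]
  intro r hr
  rw [X.op.gen_ne hr, zero_mul]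

theorem bd_filtLT (α : ℝ) : ∀ c ∈ X.filtLT K α, X.bd c ∈ X.filtLT K α := by
  intro c hc
  by_cases h : c = 0
  · rw [h, map_zero]
    exact zero_mem _
  · exact (X.level_bd c h).trans hc

theorem bd_filtLE (α : ℝ) : ∀ c ∈ X.filtLE K α, X.bd c ∈ X.filtLE K α := by
  intro c hc
  by_cases h : c = 0
  · rw [h, map_zero]
    exact zero_mem _
  · exact (X.level_bd c h).le.trans hc

end FloerNovikovComplex

section Homology

variable {K V W : Type*} [Field K] [AddCommGroup V] [Module K V] [AddCommGroup W] [Module K W]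

/-- The degree-`k` cycles of a chain complex whose underlying vector space is `V`, with degree-`j`
part `G j` and boundary operator `f`. -/
def gradedCycles (G : ℤ → Submodule K V) (f : V →ₗ[K] V) (k : ℤ) : Submodule K V :=
  G k ⊓ LinearMap.ker f

/-- The degree-`k` homology of a chain complex whose underlying vector space is `V`, with degree-`j`
part `G j` and boundary operator `f`: the degree-`k` cycles modulo the boundaries of chains of
degree `k + 1`. -/
def GradedHomology (G : ℤ → Submodule K V) (f : V →ₗ[K] V) (k : ℤ) : Type _ :=
  ↥(gradedCycles G f k) ⧸ ((G (k + 1)).map f).submoduleOf (gradedCycles G f k)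

noncomputable instance (G : ℤ → Submodule K V) (f : V →ₗ[K] V) (k : ℤ) :
    AddCommGroup (GradedHomology G f k) :=
  inferInstanceAs (AddCommGroup (_ ⧸ ((G (k + 1)).map f).submoduleOf (gradedCycles G f k)))

noncomputable instance (G : ℤ → Submodule K V) (f : V →ₗ[K] V) (k : ℤ) :
    Module K (GradedHomology G f k) :=
  inferInstanceAs (Module K (_ ⧸ ((G (k + 1)).map f).submoduleOf (gradedCycles G f k)))

/-- The homology class of a cycle. -/
noncomputable def gradedClass (G : ℤ → Submodule K V) (f : V →ₗ[K] V) (k : ℤ) :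
    gradedCycles G f k →ₗ[K] GradedHomology G f k :=
  (((G (k + 1)).map f).submoduleOf (gradedCycles G f k)).mkQ

/-- A bilinear pairing for which two boundary operators `f` and `g` are adjoint descends to
homology, by pairing representing cycles. -/
noncomputable def gradedHomologyPairing (G : ℤ → Submodule K V) (f : V →ₗ[K] V) (G' : ℤ → Submodule K W)
    (g : W →ₗ[K] W) (B : V →ₗ[K] W →ₗ[K] K) (hB : ∀ v w, B (f v) w = B v (g w)) (j k : ℤ) :
    GradedHomology G f j →ₗ[K] GradedHomology G' g k →ₗ[K] K :=
  Submodule.liftQ (((G (j + 1)).map f).submoduleOf (gradedCycles G f j))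
    (Submodule.liftQ (((G' (k + 1)).map g).submoduleOf (gradedCycles G' g k))
      (B.domRestrict₁₂ (gradedCycles G f j) (gradedCycles G' g k)).flip (by
        rintro ⟨c, hc⟩ ⟨b, -, hb⟩
        refine LinearMap.mem_ker.mpr (LinearMap.ext fun d => ?_)
        change B d.1 c = 0
        have hb' : g b = c := hb
        rw [← hb', ← hB, LinearMap.mem_ker.mp d.2.2, map_zero]
        rfl)).flip (by
    rintro ⟨d, hd⟩ ⟨x, -, hx⟩
    refine LinearMap.mem_ker.mpr (LinearMap.ext fun c => ?_)
    obtain ⟨c, rfl⟩ := Submodule.mkQ_surjective _ c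
    change B d c.1 = 0
    have hx' : f x = d := hx
    rw [← hx', hB, LinearMap.mem_ker.mp c.2.2, map_zero])

theorem gradedHomologyPairing_mk (G : ℤ → Submodule K V) (f : V →ₗ[K] V) (G' : ℤ → Submodule K W)
    (g : W →ₗ[K] W) (B : V →ₗ[K] W →ₗ[K] K) (hB : ∀ v w, B (f v) w = B v (g w)) (j k : ℤ)
    (d : gradedCycles G f j) (c : gradedCycles G' g k) :
    gradedHomologyPairing G f G' g B hB j k (gradedClass G f j d) (gradedClass G' g k c) =
      B d.1 c.1 := rfl

end Homology

namespace FloerNovikovComplex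

variable {K Γ P S : Type*} [Field K] [CommGroup Γ] (X : FloerNovikovComplex K Γ P S)

/-- `C_*^{(-∞,α)}`, as a vector space. -/
def SubLT (α : ℝ) : Type _ := ↥(X.filtLT K α)

instance (α : ℝ) : AddCommGroup (X.SubLT α) := inferInstanceAs (AddCommGroup ↥(X.filtLT K α))

instance (α : ℝ) : Module K (X.SubLT α) := inferInstanceAs (Module K ↥(X.filtLT K α))

/-- The inclusion of `C_*^{(-∞,α)}` into `C_*`. -/
def inclLT (α : ℝ) : X.SubLT α →ₗ[K] X.chains K := (X.filtLT K α).subtype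

/-- The boundary operator of the subcomplex `C_*^{(-∞,α)}`. -/
noncomputable def bdLT (α : ℝ) : X.SubLT α →ₗ[K] X.SubLT α :=
  X.bd.restrict (X.bd_filtLT α)

/-- The degree-`k` part of `C_*^{(-∞,α)}`. -/
def gradedLT (α : ℝ) (k : ℤ) : Submodule K (X.SubLT α) :=
  (X.graded K k).comap (X.inclLT α)

/-- `C_*^{(α,∞)} = C_* / C_*^{(-∞,α]}`. -/
def QuotGT (α : ℝ) : Type _ := X.chains K ⧸ X.filtLE K α

instance (α : ℝ) : AddCommGroup (X.QuotGT α) :=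
  inferInstanceAs (AddCommGroup (X.chains K ⧸ X.filtLE K α))

instance (α : ℝ) : Module K (X.QuotGT α) :=
  inferInstanceAs (Module K (X.chains K ⧸ X.filtLE K α))

/-- The projection of `C_*` onto `C_*^{(α,∞)}`. -/
def projGT (α : ℝ) : X.chains K →ₗ[K] X.QuotGT α := (X.filtLE K α).mkQ

theorem projGT_surjective (α : ℝ) : Function.Surjective (X.projGT α) :=
  (X.filtLE K α).mkQ_surjective

/-- The boundary operator of the quotient complex `C_*^{(α,∞)}`. -/
noncomputable def bdGT (α : ℝ) : X.QuotGT α →ₗ[K] X.QuotGT α :=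
  (X.filtLE K α).mapQ (X.filtLE K α) X.bd (X.bd_filtLE α)

/-- The degree-`k` part of `C_*^{(α,∞)}`. -/
def gradedGT (α : ℝ) (k : ℤ) : Submodule K (X.QuotGT α) :=
  (X.graded K k).map (X.projGT α)

/-- `Hₖ(C_*^{(-∞,α)})`. -/
abbrev HomologyLT (α : ℝ) (k : ℤ) : Type _ := GradedHomology (X.gradedLT α) (X.bdLT α) k

/-- `Hₖ(C_*^{(α,∞)})`. -/
abbrev HomologyGT (α : ℝ) (k : ℤ) : Type _ := GradedHomology (X.gradedGT α) (X.bdGT α) k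

/-- The pairing `Δ : D_* × C_* → K`, with `D_*` the Floer complex of the opposite complex. -/
noncomputable def pairingOp : X.op.chains K →ₗ[K] X.chains K →ₗ[K] K := X.pairing K

/-- The pairing `Δ_α : D_*^{(-∞,-α)} × C_*^{(α,∞)} → K` induced by `Δ`. -/
noncomputable def pairingFilt (α : ℝ) : X.op.SubLT (-α) →ₗ[K] X.QuotGT α →ₗ[K] K :=
  ((X.filtLE K α).liftQ (X.pairingOp.comp (X.op.inclLT (-α))).flip (by
      intro c hc
      refine LinearMap.mem_ker.mpr (LinearMap.ext fun d => ?_)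
      exact X.pairing_filt α d.2 hc)).flip

theorem pairingFilt_proj (α : ℝ) (d : X.op.SubLT (-α)) (c : X.chains K) :
    X.pairingFilt α d (X.projGT α c) = X.pairingOp (X.op.inclLT (-α) d) c := rfl

theorem inclLT_bdLT (α : ℝ) (c : X.SubLT α) : X.inclLT α (X.bdLT α c) = X.bd (X.inclLT α c) := rfl

theorem bdGT_projGT (α : ℝ) (c : X.chains K) : X.bdGT α (X.projGT α c) = X.projGT α (X.bd c) := rfl

theorem pairingFilt_bd (α : ℝ) (d : X.op.SubLT (-α)) (c : X.QuotGT α) :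
    X.pairingFilt α (X.op.bdLT (-α) d) c = X.pairingFilt α d (X.bdGT α c) := by
  obtain ⟨c, rfl⟩ := X.projGT_surjective α c
  rw [bdGT_projGT, pairingFilt_proj, pairingFilt_proj, inclLT_bdLT]
  exact X.pairing_delta _ c

/-- The homological pairing `H₋ₖ(D_*^{(-∞,-α)}) × Hₖ(C_*^{(α,∞)}) → K` induced by `Δ_α` on
representing cycles. -/
noncomputable def homologyPairing (α : ℝ) (k : ℤ) :
    X.op.HomologyLT (-α) (-k) →ₗ[K] X.HomologyGT α k →ₗ[K] K :=
  gradedHomologyPairing (X.op.gradedLT (-α)) (X.op.bdLT (-α)) (X.gradedGT α) (X.bdGT α)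
    (X.pairingFilt α) (X.pairingFilt_bd α) (-k) k

end FloerNovikovComplex

/-!
Since `ω` is injective on `ker deg`, it identifies `ker deg` with an additive subgroup `G` of `ℝ`,
and the Novikov series with exponents in `G` form a field `Λ`. Each `C_k` is a finite-dimensional
`Λ`-vector space whose filtration comes from a weighted nonarchimedean norm, `∂ : C_k → C_{k-1}` is
a matrix over `Λ`, and `Δ` is the constant term of the dot product.

Over a field with a valuation of arbitrary rank and without any completeness, every subspace of
such a space is the range of a projection which does not increase the norm: subtract multiples of a
vector at a coordinate where its norm is attained, and induct on the dimension. Factoring such a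
projection onto the range of `∂` as `∂ h` gives a generalized inverse `h`, with `∂ h ∂ = ∂`, and the
transpose of its matrix gives an adjoint `h'` with `Δ(h' d, c) = Δ(d, h c)`.

The spaces `D^{(-∞,-α)}` and `C^{(-∞,α]}` are the exact annihilators of each other under `Δ`, in
complementary degrees. A chain `d` which annihilates all relative cycles is therefore `δ (h' d)`
with `h' d` of level less than `-α`. A chain `c` which annihilates all cycles of
`D^{(-∞,-α)}` differs from `∂ (h c)` by an element of level at most `α`, because
`Δ(d, c - ∂ h c) = Δ(d - h' δ d, c)` and `d - h' δ d` is a cycle of level less than `-α` when `d`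
has level less than `-α`.
-/

section Novikov

open HahnSeries

theorem isPWO_of_finite_inter_Iio {A : Type*} [LinearOrder A] {s : Set A}
    (h : ∀ a, (s ∩ Set.Iio a).Finite) : s.IsPWO := by
  refine Set.isPWO_iff_isWF.mpr (Set.isWF_iff_no_descending_seq.mpr fun f hf hfs => ?_)
  have hinj : Function.Injective fun n => f (n + 1) := hf.injective.comp (add_left_injective 1)
  have hmem (n : ℕ) : f (n + 1) ∈ s ∩ Set.Iio (f 0) := ⟨hfs _, hf n.succ_pos⟩
  exact Set.infinite_of_injective_forall_mem hinj hmem (h (f 0))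

theorem finsum_comp_eq_of_support_subset_range {ι κ M : Type*} [AddCommMonoid M] {j : ι → κ}
    (hj : Function.Injective j) {f : κ → M} (hf : Function.support f ⊆ Set.range j) :
    ∑ᶠ i, f (j i) = ∑ᶠ x, f x := by
  rw [← finsum_mem_range hj, finsum_mem_def, Set.indicator_eq_self.mpr hf]

variable {A R K : Type*} [AddCommGroup A] [LinearOrder A] [IsOrderedAddMonoid A]

theorem hahnSeries_coeff_mul_eq_finsum [NonUnitalNonAssocSemiring R] (x y : HahnSeries A R)
    (a : A) : (x * y).coeff a = ∑ᶠ b, x.coeff (a - b) * y.coeff b := by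
  classical
  set D := Finset.antidiagonal x.isPWO_support y.isPWO_support a
  have hD {p : A × A} : p ∈ D → p.1 = a - p.2 := fun hp =>
    eq_sub_of_add_eq (Finset.mem_antidiagonal.mp hp).2.2
  have hinj : Set.InjOn Prod.snd (D : Set (A × A)) := fun p hp q hq h =>
    Prod.ext (by rw [hD hp, hD hq, h]) h
  calc (x * y).coeff a = ∑ p ∈ D, x.coeff (a - p.2) * y.coeff p.2 := by
        rw [coeff_mul]
        exact Finset.sum_congr rfl fun p hp => by rw [hD hp]
    _ = ∑ b ∈ D.image Prod.snd, x.coeff (a - b) * y.coeff b :=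
        (Finset.sum_image (f := fun b => x.coeff (a - b) * y.coeff b) hinj).symm
    _ = ∑ᶠ b, x.coeff (a - b) * y.coeff b := by
        refine (finsum_eq_sum_of_support_subset _ fun b hb => ?_).symm
        exact Finset.mem_coe.mpr <| Finset.mem_image.mpr ⟨(a - b, b), Finset.mem_antidiagonal.mpr
          ⟨left_ne_zero_of_mul hb, right_ne_zero_of_mul hb, sub_add_cancel a b⟩, rfl⟩

variable (A R) in
/-- The Novikov ring with exponents in `A`, as a subring of the Hahn series: a Novikov series has
only finitely many terms below each exponent. -/
def novikovSubring [Ring R] : Subring (HahnSeries A R) where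
  carrier := {x | ∀ a, (x.support ∩ Set.Iio a).Finite}
  zero_mem' := by simp
  one_mem' a := (Set.finite_singleton 0).subset fun b hb => support_single_subset hb.1
  add_mem' hx hy a := ((hx a).union (hy a)).subset fun b hb =>
    (support_add_subset _ _ hb.1).imp (fun h => ⟨h, hb.2⟩) fun h => ⟨h, hb.2⟩
  neg_mem' hx a := by simpa only [support_neg] using hx a
  mul_mem' {x y} hx hy a := by
    refine ((hx (a - y.order)).add (hy (a - x.order))).subset ?_
    rintro _ ⟨hmem, hlt⟩
    obtain ⟨b, hb, c, hc, rfl⟩ := support_mul_subset hmem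
    exact ⟨b, ⟨hb, lt_sub_iff_add_lt.mpr
        ((add_le_add_right (order_le_of_coeff_ne_zero hc) b).trans_lt hlt)⟩,
      c, ⟨hc, lt_sub_iff_add_lt'.mpr
        ((add_le_add_left (order_le_of_coeff_ne_zero hb) c).trans_lt hlt)⟩, rfl⟩

theorem mem_novikovSubring_iff [Ring R] {x : HahnSeries A R} :
    x ∈ novikovSubring A R ↔ ∀ a, (x.support ∩ Set.Iio a).Finite :=
  Iff.rfl

theorem single_mem_novikovSubring [Ring R] (a : A) (r : R) : single a r ∈ novikovSubring A R :=
  mem_novikovSubring_iff.mpr fun _ =>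
    (Set.finite_singleton a).subset fun _ hb => support_single_subset hb.1

theorem hsum_powers_mem_novikovSubring [Archimedean A] [CommRing R] {u : HahnSeries A R}
    (hu : u ∈ novikovSubring A R) : (SummableFamily.powers u).hsum ∈ novikovSubring A R := by
  by_cases hpos : 0 < u.orderTop
  swap
  · rw [SummableFamily.powers_of_not_orderTop_pos hpos, SummableFamily.hsum_single]
    exact one_mem _
  refine mem_novikovSubring_iff.mpr fun a => ?_
  obtain ⟨N, hN⟩ : ∃ N : ℕ, (a : WithTop A) ≤ N • u.orderTop := by
    cases h : u.orderTop with
    | top => exact ⟨1, by simp only [one_nsmul, le_top]⟩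
    | coe ε =>
      obtain ⟨N, hN⟩ := Archimedean.arch a (WithTop.coe_pos.mp (h ▸ hpos))
      exact ⟨N, WithTop.coe_nsmul ε N ▸ WithTop.coe_le_coe.mpr hN⟩
  have hpow {n : ℕ} (hn : N ≤ n) : (a : WithTop A) ≤ (u ^ n).orderTop :=
    calc (a : WithTop A) ≤ N • u.orderTop := hN
      _ ≤ n • u.orderTop := nsmul_le_nsmul_left hpos.le hn
      _ ≤ (u ^ n).orderTop := orderTop_nsmul_le_orderTop_pow
  refine ((Set.finite_Iio N).biUnion fun n _ => pow_mem hu n a).subset ?_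
  rintro b ⟨hb, hba⟩
  obtain ⟨n, hn⟩ : ∃ n, b ∈ (u ^ n).support := by
    by_contra! h
    refine hb ?_
    rw [SummableFamily.coeff_hsum, SummableFamily.coe_powers hpos]
    exact finsum_eq_zero_of_forall_eq_zero fun n => not_not.mp (h n)
  refine Set.mem_biUnion (Set.mem_Iio.mpr (not_le.mp fun hNn => ?_)) ⟨hn, hba⟩
  exact hn (coeff_eq_zero_of_lt_orderTop ((WithTop.coe_lt_coe.mpr hba).trans_le (hpow hNn)))

variable (A K) in
/-- The Novikov ring over a field, as a subfield of the Hahn series. The exponent group has to be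
archimedean for the geometric series which gives the inverse to lie in the Novikov ring. -/
def novikovField [Archimedean A] [Field K] : Subfield (HahnSeries A K) where
  __ := novikovSubring A K
  inv_mem' x hx := by
    rw [inv_def]
    exact mul_mem (single_mem_novikovSubring _ _) <| hsum_powers_mem_novikovSubring <|
      sub_mem (one_mem _) <| mul_mem (single_mem_novikovSubring _ _) hx

/-- The valuation on the Novikov field with exponent group `G ≤ ℝ` given by the least exponent. -/
noncomputable def novikovVal (G : AddSubgroup ℝ) (K : Type*) [Field K] :
    AddValuation (novikovField G K) (WithTop ℝ) :=
  ((addVal G K).map G.subtype.withTopMap rfl (WithTop.monotone_map_iff.mpr fun _ _ h => h)).comap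
    (novikovField G K).subtype

theorem coe_le_coe_add_novikovVal_iff [Field K] {G : AddSubgroup ℝ} {x : novikovField G K}
    {a C : ℝ} :
    (C : WithTop ℝ) ≤ a + novikovVal G K x ↔ ∀ r : G, x.1.coeff r ≠ 0 → C ≤ a + r := by
  have hval : novikovVal G K x = x.1.orderTop.map G.subtype := rfl
  obtain hx | hx := eq_or_ne x.1 0
  · simp [hval, hx]
  rw [hval, ← order_eq_orderTop_of_ne_zero hx, WithTop.map_coe, ← WithTop.coe_add,
    WithTop.coe_le_coe]
  refine ⟨fun h r hr => h.trans ?_, fun h => h _ (coeff_order_eq_zero.not.mpr hx)⟩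
  exact add_le_add_right (Subtype.coe_le_coe.mpr (order_le_of_coeff_ne_zero hr)) a

theorem finite_setOf_coeff_ne_zero_of_lt [Ring R] {G : AddSubgroup ℝ}
    {x : HahnSeries G R} (hx : x ∈ novikovSubring G R) (C : ℝ) :
    {r : G | x.coeff r ≠ 0 ∧ (r : ℝ) < C}.Finite := by
  obtain hG | hG := subsingleton_or_nontrivial G
  · exact Set.toFinite _
  obtain ⟨ε, hε⟩ := exists_zero_lt (α := G)
  obtain ⟨n, hn⟩ := Archimedean.arch C (show (0 : ℝ) < ε from hε)
  exact (mem_novikovSubring_iff.mp hx (n • ε)).subset fun r hr => ⟨hr.1, hr.2.trans_le hn⟩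

theorem novikovField_coeff_dotProduct [Field K] {G : AddSubgroup ℝ} {T : Type*} [Fintype T]
    (x y : T → novikovField G K) (r : G) :
    (x ⬝ᵥ y).1.coeff r = ∑ t, ∑ᶠ s, (x t).1.coeff (r - s) * (y t).1.coeff s := by
  have h : (x ⬝ᵥ y).1 = ∑ t, (x t).1 * (y t).1 :=
    map_sum (novikovField G K).subtype (fun t => x t * y t) Finset.univ
  rw [h, HahnSeries.coeff_sum]
  exact Finset.sum_congr rfl fun t _ => hahnSeries_coeff_mul_eq_finsum _ _ _

end Novikov

section UltrametricProjection

variable {F Γ₀ T : Type*} [Field F] [LinearOrderedAddCommMonoidWithTop Γ₀]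

/-- A linear map is nonexpanding when it does not decrease `min_t (w t + v (x t))`. This is the
additive form of not increasing a weighted supremum norm. -/
def IsNonexpanding (v : AddValuation F Γ₀) (w : T → Γ₀) (E : (T → F) →ₗ[F] T → F) : Prop :=
  ∀ x C, (∀ t, C ≤ w t + v (x t)) → ∀ t, C ≤ w t + v (E x t)

namespace IsNonexpanding

variable {v : AddValuation F Γ₀} {w : T → Γ₀} {E E' : (T → F) →ₗ[F] T → F}

theorem zero : IsNonexpanding v w 0 := fun _ _ _ _ => by
  simp only [LinearMap.zero_apply, Pi.zero_apply, AddValuation.map_zero, add_top, le_top]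

theorem id : IsNonexpanding v w LinearMap.id := fun _ _ hx => hx

theorem add (hE : IsNonexpanding v w E) (hE' : IsNonexpanding v w E') :
    IsNonexpanding v w (E + E') := fun x C hx t =>
  calc C ≤ min (w t + v (E x t)) (w t + v (E' x t)) := le_min (hE x C hx t) (hE' x C hx t)
    _ = w t + min (v (E x t)) (v (E' x t)) := (min_add_add_left _ _ _)
    _ ≤ w t + v ((E + E') x t) := by gcongr; exact v.map_add _ _

theorem neg (hE : IsNonexpanding v w E) : IsNonexpanding v w (-E) := fun x C hx t => by
  simpa only [LinearMap.neg_apply, Pi.neg_apply, AddValuation.map_neg] using hE x C hx t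

theorem comp (hE : IsNonexpanding v w E) (hE' : IsNonexpanding v w E') :
    IsNonexpanding v w (E ∘ₗ E') := fun x C hx => hE _ C (hE' x C hx)

end IsNonexpanding

variable [Finite T] (v : AddValuation F Γ₀) (w : T → Γ₀)

theorem exists_isProj_span_singleton_isNonexpanding (b : T → F) :
    ∃ E : (T → F) →ₗ[F] T → F, LinearMap.IsProj (Submodule.span F {b}) E ∧
      IsNonexpanding v w E := by
  obtain rfl | hb := eq_or_ne b 0
  · rw [Submodule.span_zero_singleton]
    exact ⟨0, ⟨fun _ => zero_mem _, fun x hx => hx.symm⟩, .zero⟩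
  obtain ⟨p, hp, hmin⟩ := Set.exists_min_image {t | b t ≠ 0} (fun t => w t + v (b t))
    (Set.toFinite _) (Function.ne_iff.mp hb)
  refine ⟨((b p)⁻¹ • LinearMap.proj p).smulRight b, ⟨fun x => ?_, fun x hx => ?_⟩,
    fun x C hx t => ?_⟩
  · exact Submodule.smul_mem _ _ (Submodule.mem_span_singleton_self b)
  · obtain ⟨r, rfl⟩ := Submodule.mem_span_singleton.mp hx
    change ((b p)⁻¹ * (r * b p)) • b = r • b
    rw [mul_comm r, inv_mul_cancel_left₀ hp]
  change C ≤ w t + v ((b p)⁻¹ * x p * b t)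
  by_cases ht : b t = 0
  · rw [ht, mul_zero, v.map_zero, add_top]
    exact le_top
  calc C ≤ w p + v (x p) := hx p
    _ = w p + v (b p) + v ((b p)⁻¹ * x p) := by
      rw [add_assoc, ← v.map_mul, mul_inv_cancel_left₀ hp]
    _ ≤ w t + v (b t) + v ((b p)⁻¹ * x p) := add_le_add_left (hmin t ht) _
    _ = w t + v ((b p)⁻¹ * x p * b t) := by rw [add_assoc, ← v.map_mul, mul_comm (b t)]

theorem exists_isProj_isNonexpanding (B : Submodule F (T → F)) :
    ∃ E : (T → F) →ₗ[F] T → F, LinearMap.IsProj B E ∧ IsNonexpanding v w E := by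
  induction B, IsNoetherian.noetherian B using Submodule.fg_sup_span_induction with
  | bot => exact ⟨0, ⟨fun _ => zero_mem _, fun x hx => hx.symm⟩, .zero⟩
  | sup N b _ ih =>
    obtain ⟨E, hE, hE'⟩ := ih
    obtain ⟨R, hR, hR'⟩ := exists_isProj_span_singleton_isNonexpanding v w (b - E b)
    refine ⟨E + R ∘ₗ (LinearMap.id - E), ⟨fun x => ?_, fun x hx => ?_⟩,
      hE'.add (hR'.comp (sub_eq_add_neg LinearMap.id E ▸ .add .id hE'.neg))⟩
    · have hspan : Submodule.span F {b - E b} ≤ N ⊔ Submodule.span F {b} :=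
        (Submodule.span_singleton_le_iff_mem _ _).mpr <| sub_mem
          (Submodule.mem_sup_right (Submodule.mem_span_singleton_self b))
          (Submodule.mem_sup_left (hE.map_mem b))
      exact add_mem (Submodule.mem_sup_left (hE.map_mem x)) (hspan (hR.map_mem _))
    · obtain ⟨y, hy, z, hz, rfl⟩ := Submodule.mem_sup.mp hx
      obtain ⟨r, rfl⟩ := Submodule.mem_span_singleton.mp hz
      have hb : R (b - E b) = b - E b := hR.map_id _ (Submodule.mem_span_singleton_self _)
      have hy' : E y = y := hE.map_id y hy
      simp only [LinearMap.add_apply, LinearMap.comp_apply, LinearMap.sub_apply,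
        LinearMap.id_apply, map_add, map_sub, map_smul, hy'] at hb ⊢
      rw [hb, sub_self, add_zero, add_sub_cancel]

theorem exists_comp_comp_eq_self_isNonexpanding {V : Type*} [AddCommGroup V] [Module F V]
    (f : V →ₗ[F] T → F) :
    ∃ h : (T → F) →ₗ[F] V, f ∘ₗ h ∘ₗ f = f ∧ IsNonexpanding v w (f ∘ₗ h) := by
  obtain ⟨E, hE, hEle⟩ := exists_isProj_isNonexpanding v w (LinearMap.range f)
  obtain ⟨g, hg⟩ := f.rangeRestrict.exists_rightInverse_of_surjective f.range_rangeRestrict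
  have hfg (y : LinearMap.range f) : f (g y) = y := congrArg Subtype.val (LinearMap.congr_fun hg y)
  have hfh : f ∘ₗ g ∘ₗ hE.codRestrict = E := LinearMap.ext fun x => hfg (hE.codRestrict x)
  refine ⟨g ∘ₗ hE.codRestrict, LinearMap.ext fun x => ?_, hfh.symm ▸ hEle⟩
  exact (LinearMap.congr_fun hfh (f x)).trans (hE.map_id (f x) (LinearMap.mem_range_self f x))

end UltrametricProjection

namespace FloerNovikovData

variable {Γ P S : Type*} [CommGroup Γ] (X : FloerNovikovData Γ P S)

/-- The group of periods of the elements of degree zero. -/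
def periodGroup : AddSubgroup ℝ where
  carrier := {r | ∃ g, X.deg g = 0 ∧ X.period g = r}
  zero_mem' := ⟨1, X.deg_one, X.period_one⟩
  add_mem' := by
    rintro _ _ ⟨g, hg, rfl⟩ ⟨h, hh, rfl⟩
    exact ⟨g * h, by rw [X.deg_mul, hg, hh, add_zero], X.period_mul g h⟩
  neg_mem' := by
    rintro _ ⟨g, hg, rfl⟩
    exact ⟨g⁻¹, by rw [X.deg_inv, hg, neg_zero], X.period_inv g⟩

/-- A trivialization of the generators of grading `k` over a set of orbits `T`: the element `σ r` of
`Γ` has degree zero and period `r`, and acts on the generators by translation of the second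
coordinate. -/
structure Frame {G : AddSubgroup ℝ} (σ : G → Γ) (k : ℤ) (T : Type*) where
  point : T × G ≃ {p // X.gr p = k}
  height : T → ℝ
  action_point : ∀ t r, X.action (point (t, r)) = height t - r
  act_point : ∀ s t r, X.act (σ s) (point (t, r)) = point (t, s + r)

theorem exists_section_period (hinj : Set.InjOn X.period {g | X.deg g = 0}) :
    ∃ σ : X.periodGroup → Γ, (∀ r, X.period (σ r) = r) ∧ (∀ s r, σ (s + r) = σ s * σ r) ∧
      ∀ g, X.deg g = 0 ↔ ∃ r, σ r = g := by
  choose σ hdeg hper using fun r : X.periodGroup => r.2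
  have hdeg_mul (s r) : X.deg (σ s * σ r) = 0 := by rw [X.deg_mul, hdeg, hdeg, add_zero]
  refine ⟨σ, hper, fun s r => hinj (hdeg _) (hdeg_mul s r) ?_, fun g => ⟨fun hg => ?_, ?_⟩⟩
  · rw [hper, X.period_mul, hper, hper, AddSubgroup.coe_add]
  · exact ⟨⟨X.period g, g, hg, rfl⟩, hinj (hdeg _) hg (hper _)⟩
  · rintro ⟨r, rfl⟩
    exact hdeg r

theorem nonempty_frame {G : AddSubgroup ℝ} {σ : G → Γ} (hper : ∀ r, X.period (σ r) = r)
    (hadd : ∀ s r, σ (s + r) = σ s * σ r) (hdeg : ∀ g, X.deg g = 0 ↔ ∃ r, σ r = g) (k : ℤ) :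
    Nonempty (X.Frame σ k {s : S // ∃ p, X.proj p = s ∧ X.gr p = k}) := by
  choose rep hproj hgr using fun s : {s : S // ∃ p, X.proj p = s ∧ X.gr p = k} => s.2
  have hgr_act (t r) : X.gr (X.act (σ r) (rep t)) = k := by
    rw [X.gr_act, hgr, (hdeg _).mpr ⟨r, rfl⟩, sub_zero]
  have hproj_act (t r) : X.proj (X.act (σ r) (rep t)) = t := by
    rw [← (X.proj_eq_iff (rep t) _).mpr ⟨σ r, rfl⟩, hproj]
  let point (y : {s : S // ∃ p, X.proj p = s ∧ X.gr p = k} × G) : {p // X.gr p = k} :=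
    ⟨X.act (σ y.2) (rep y.1), hgr_act y.1 y.2⟩
  have hpoint_inj : Function.Injective point := by
    rintro ⟨t, r⟩ ⟨t', r'⟩ h
    have hact : X.act (σ r) (rep t) = X.act (σ r') (rep t') := congrArg Subtype.val h
    obtain rfl : t = t' := Subtype.ext (by rw [← hproj_act t r, hact, hproj_act])
    obtain rfl : r = r' := Subtype.ext (by rw [← hper r, X.act_left_injective _ hact, hper])
    rfl
  have hpoint_surj : Function.Surjective point := by
    rintro ⟨p, hp⟩
    let t : {s : S // ∃ p, X.proj p = s ∧ X.gr p = k} := ⟨X.proj p, p, rfl, hp⟩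
    obtain ⟨g, hg⟩ := (X.proj_eq_iff (rep t) p).mp (hproj t)
    have hgr_eq : k - X.deg g = k := by rw [← hgr t, ← X.gr_act, hg, hp, hgr t]
    obtain ⟨r, rfl⟩ := (hdeg g).mp (sub_eq_self.mp hgr_eq)
    exact ⟨(t, r), Subtype.ext hg⟩
  exact ⟨{
    point := Equiv.ofBijective point ⟨hpoint_inj, hpoint_surj⟩
    height := fun t => X.action (rep t)
    action_point := fun t r => (X.action_act _ _).trans (by rw [hper])
    act_point := fun s t r => (X.mul_act _ _ _).symm.trans (by rw [← hadd]; rfl) }⟩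

namespace Frame

variable {X} {G : AddSubgroup ℝ} {σ : G → Γ} {k : ℤ} {T K : Type*} [Field K]
  (F : X.Frame σ k T)

theorem exists_point_eq {p : P} (hp : X.gr p = k) : ∃ t r, F.point (t, r) = p := by
  obtain ⟨⟨t, r⟩, h⟩ := F.point.surjective ⟨p, hp⟩
  exact ⟨t, r, congrArg Subtype.val h⟩

theorem coe_point_injective : Function.Injective fun y => (F.point y : P) :=
  Subtype.val_injective.comp F.point.injective

/-- The frame of the opposite data with the same generators. The second coordinate changes sign
because `Γ` acts inversely. -/
def op : X.op.Frame σ (-k) T where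
  point := ((Equiv.refl T).prodCongr (Equiv.neg G)).trans
    (F.point.trans (Equiv.subtypeEquivRight fun _ => neg_inj.symm))
  height t := -F.height t
  action_point t r := (congrArg Neg.neg (F.action_point t (-r))).trans <| by
    rw [AddSubgroup.coe_neg, sub_neg_eq_add, neg_add']
  act_point s t r := by
    have h := F.act_point s t (-(s + r))
    rw [neg_add, add_neg_cancel_left] at h
    change X.act (σ s)⁻¹ (F.point (t, -r)) = F.point (t, -(s + r))
    rw [← h, X.act_inv_act, neg_add]

theorem finsum_eq_sum [Fintype T] {M : Type*} [AddCommMonoid M] {f : P → M}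
    (hf : (Function.support f).Finite) (hk : ∀ p, f p ≠ 0 → X.gr p = k) :
    ∑ᶠ p, f p = ∑ t, ∑ᶠ r, f (F.point (t, r)) := by
  rw [← finsum_comp_eq_of_support_subset_range F.coe_point_injective, finsum_curry,
    finsum_eq_sum_of_fintype]
  · exact hf.preimage F.coe_point_injective.injOn
  · intro p hp
    obtain ⟨t, r, rfl⟩ := F.exists_point_eq (hk p hp)
    exact ⟨(t, r), rfl⟩

theorem finite_coeff_inter_Iio (c : X.chains K) (t : T) (a : G) :
    (Function.support (fun r => c.1 (F.point (t, r))) ∩ Set.Iio a).Finite := by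
  refine ((c.2.2 (F.height t - a)).preimage
    (F.coe_point_injective.comp (Prod.mk_right_injective t)).injOn).subset ?_
  rintro r ⟨hr, hra⟩
  exact ⟨hr, (sub_lt_sub_left hra _).trans_eq (F.action_point t r).symm⟩

/-- The coordinates over the Novikov field of the degree `k` part of a chain. -/
noncomputable def coords (c : X.chains K) (t : T) : novikovField G K :=
  ⟨⟨fun r => c.1 (F.point (t, r)), isPWO_of_finite_inter_Iio (F.finite_coeff_inter_Iio c t)⟩,
    mem_novikovSubring_iff.mpr (F.finite_coeff_inter_Iio c t)⟩

theorem coords_coeff (c : X.chains K) (t : T) (r : G) :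
    (F.coords c t).1.coeff r = c.1 (F.point (t, r)) :=
  rfl

theorem op_coords_coeff (d : X.op.chains K) (t : T) (r : G) :
    (F.op.coords d t).1.coeff r = d.1 (F.point (t, -r)) :=
  rfl

theorem coords_injOn : Set.InjOn F.coords (X.graded K k : Set (X.chains K)) := by
  refine fun c hc c' hc' h => Subtype.ext (funext fun p => ?_)
  by_cases hp : X.gr p = k
  · obtain ⟨t, r, rfl⟩ := F.exists_point_eq hp
    rw [← F.coords_coeff, h, F.coords_coeff]
  · rw [not_not.mp (mt (hc p) hp), not_not.mp (mt (hc' p) hp)]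

theorem exists_mem_graded_coords_eq [Finite T] (x : T → novikovField G K) :
    ∃ c ∈ X.graded K k, F.coords c = x := by
  let f : P → K := Function.extend (fun y => (F.point y : P)) (fun y => (x y.1).1.coeff y.2) 0
  have hf (t : T) (r : G) : f (F.point (t, r)) = (x t).1.coeff r :=
    F.coe_point_injective.extend_apply _ _ (t, r)
  have hgr (p : P) (hp : f p ≠ 0) : X.gr p = k := by
    obtain ⟨y, -, rfl⟩ := Function.support_extend_zero_subset hp
    exact (F.point y).2
  have hfin (C : ℝ) : {p | f p ≠ 0 ∧ C < X.action p}.Finite := by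
    refine (Set.finite_iUnion fun t => (finite_setOf_coeff_ne_zero_of_lt (x t).2
      (F.height t - C)).image fun r => (F.point (t, r) : P)).subset ?_
    rintro p ⟨hp, hC⟩
    obtain ⟨t, r, rfl⟩ := F.exists_point_eq (hgr p hp)
    rw [F.action_point] at hC
    exact Set.mem_iUnion.mpr ⟨t, r, ⟨hf t r ▸ hp, lt_sub_comm.mp hC⟩, rfl⟩
  refine ⟨⟨f, (Set.finite_singleton k).subset ?_, hfin⟩, hgr,
    funext fun t => Subtype.ext (HahnSeries.ext (funext (hf t)))⟩
  rintro _ ⟨p, hp, rfl⟩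
  exact hgr p hp

theorem mem_filtLE_iff {c : X.chains K} (hc : c ∈ X.graded K k) {C : ℝ} :
    c ∈ X.filtLE K C ↔
      ∀ t, ((-C : ℝ) : WithTop ℝ) ≤ (-F.height t : ℝ) + novikovVal G K (F.coords c t) := by
  simp only [coe_le_coe_add_novikovVal_iff, coords_coeff]
  refine (X.level_le_iff c C).trans ⟨fun h t r hr => ?_, fun h p hp => ?_⟩
  · have := h _ hr
    rw [F.action_point] at this
    linarith
  · obtain ⟨t, r, rfl⟩ := F.exists_point_eq (hc p hp)
    rw [F.action_point]
    linarith [h t r hp]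

theorem pairing_eq [Fintype T] (d : X.op.chains K) {c : X.chains K} (hc : c ∈ X.graded K k) :
    X.pairing K d c = (F.op.coords d ⬝ᵥ F.coords c).1.coeff 0 := by
  rw [X.pairing_apply, novikovField_coeff_dotProduct, F.finsum_eq_sum (X.pairing_finite d c)
    fun p hp => hc p (right_ne_zero_of_mul hp)]
  refine Finset.sum_congr rfl fun t _ => finsum_congr fun r => ?_
  rw [F.op_coords_coeff, F.coords_coeff, zero_sub, neg_neg]

end Frame

end FloerNovikovData

namespace FloerNovikovData

variable {Γ P S K : Type*} [CommGroup Γ] [Field K] (X : FloerNovikovData Γ P S)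

theorem eq_of_gen_apply_ne_zero {p q : P} (h : (X.gen K p).1 q ≠ 0) : q = p := by
  classical
  by_contra hq
  exact h (Pi.single_eq_of_ne hq 1)

theorem gen_mem_graded {p : P} {k : ℤ} (hp : X.gr p = k) : X.gen K p ∈ X.graded K k :=
  fun _ hq => X.eq_of_gen_apply_ne_zero hq ▸ hp

theorem gen_mem_filtLE {p : P} {α : ℝ} (hp : X.action p ≤ α) : X.gen K p ∈ X.filtLE K α :=
  (X.level_le_iff _ α).mpr fun _ hq => X.eq_of_gen_apply_ne_zero hq ▸ hp

theorem gen_mem_filtLT {p : P} {α : ℝ} (hp : X.action p < α) : X.gen K p ∈ X.filtLT K α :=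
  (X.level_lt_iff _ α).mpr fun _ hq => X.eq_of_gen_apply_ne_zero hq ▸ hp

theorem pairing_gen_right (d : X.op.chains K) (q : P) : X.pairing K d (X.gen K q) = d.1 q := by
  classical
  refine (finsum_eq_single _ q fun p hp => ?_).trans ?_
  · exact mul_eq_zero_of_right _ (Pi.single_eq_of_ne hp 1)
  · exact (congrArg _ (Pi.single_eq_same q 1)).trans (mul_one _)

theorem pairing_gen_left (p : P) (c : X.chains K) : X.pairing K (X.op.gen K p) c = c.1 p := by
  classical
  refine (finsum_eq_single _ p fun q hq => ?_).trans ?_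
  · exact mul_eq_zero_of_left (Pi.single_eq_of_ne hq 1) _
  · exact (congrArg (· * _) (Pi.single_eq_same p 1)).trans (one_mul _)

theorem op_graded_ext {k : ℤ} {d d' : X.op.chains K} (hd : d ∈ X.op.graded K (-k))
    (hd' : d' ∈ X.op.graded K (-k))
    (h : ∀ c ∈ X.graded K k, X.pairing K d c = X.pairing K d' c) : d = d' := by
  refine Subtype.ext (funext fun p => ?_)
  by_cases hp : X.gr p = k
  · rw [← X.pairing_gen_right, h _ (X.gen_mem_graded hp), X.pairing_gen_right]
  · have hp' : ¬X.op.gr p = -k := fun h => hp (neg_injective h)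
    rw [not_not.mp (mt (hd p) hp'), not_not.mp (mt (hd' p) hp')]

theorem mem_op_filtLT_iff_forall_pairing_eq_zero {α : ℝ} {k : ℤ} {d : X.op.chains K}
    (hd : d ∈ X.op.graded K (-k)) :
    d ∈ X.op.filtLT K (-α) ↔ ∀ c ∈ X.graded K k, c ∈ X.filtLE K α → X.pairing K d c = 0 := by
  refine ⟨fun hα c _ hc => X.pairing_filt α hα hc, fun h =>
    (X.op.level_lt_iff d _).mpr fun p hp => neg_lt_neg (lt_of_not_ge fun hpα => hp ?_)⟩
  rw [← X.pairing_gen_right]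
  exact h _ (X.gen_mem_graded (neg_injective (hd p hp))) (X.gen_mem_filtLE hpα)

theorem mem_filtLE_iff_forall_pairing_eq_zero {α : ℝ} {k : ℤ} {c : X.chains K}
    (hc : c ∈ X.graded K k) :
    c ∈ X.filtLE K α ↔
      ∀ d ∈ X.op.graded K (-k), d ∈ X.op.filtLT K (-α) → X.pairing K d c = 0 := by
  refine ⟨fun hα d _ hd => X.pairing_filt α hd hα, fun h =>
    (X.level_le_iff c α).mpr fun p hp => le_of_not_gt fun hpα => hp ?_⟩
  rw [← X.pairing_gen_left]
  have hgr : X.op.gr p = -k := congrArg Neg.neg (hc p hp)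
  exact h _ (X.op.gen_mem_graded hgr) (X.op.gen_mem_filtLT (neg_lt_neg hpα))

end FloerNovikovData

namespace FloerNovikovComplex

variable {K Γ P S : Type*} [Field K] [CommGroup Γ] (X : FloerNovikovComplex K Γ P S)

theorem bd_mem_graded {j k : ℤ} (hjk : k - 1 = j) {c : X.chains K} (hc : c ∈ X.graded K k) :
    X.bd c ∈ X.graded K j :=
  hjk ▸ X.bd_graded k c hc

theorem delta_mem_graded {j k : ℤ} (hjk : k - 1 = j) {d : X.toFloerNovikovData.op.chains K}
    (hd : d ∈ X.toFloerNovikovData.op.graded K (-j)) :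
    X.delta d ∈ X.toFloerNovikovData.op.graded K (-k) :=
  X.op.bd_mem_graded (by rw [← hjk, neg_sub', sub_neg_eq_add, add_sub_cancel_right]) hd

section BoundaryMatrix

open scoped Matrix

variable {G : AddSubgroup ℝ} {σ : G → Γ} {j k : ℤ} {T T' : Type*}
  (F : X.toFloerNovikovData.Frame σ k T) (F' : X.toFloerNovikovData.Frame σ j T')

/-- The matrix of the boundary operator over the Novikov field, with respect to frames of the source
and of the target. -/
noncomputable def bdMatrix : Matrix T' T (novikovField G K) :=
  Matrix.of fun t' t => F'.coords (X.bd (X.gen K (F.point (t, 0)))) t'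

theorem coeff_point_point (t : T) (t' : T') (r r' : G) :
    X.coeff (F.point (t, r)) (F'.point (t', r')) =
      (X.bdMatrix F F' t' t).1.coeff (r' - r) := by
  have h := X.coeff_act (σ r) (F.point (t, 0)) (F'.point (t', r' - r))
  rwa [F.act_point, F'.act_point, add_zero, add_sub_cancel] at h

theorem bdMatrix_mulVec_coords [Fintype T] {c : X.chains K} (hc : c ∈ X.graded K k) :
    X.bdMatrix F F' *ᵥ F.coords c = F'.coords (X.bd c) := by
  refine funext fun t' => Subtype.ext (HahnSeries.ext (funext fun r' => ?_))
  rw [F'.coords_coeff, X.bd_apply, F.finsum_eq_sum (X.bd_apply_finite c _)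
    fun p hp => hc p (left_ne_zero_of_mul hp), Matrix.mulVec, novikovField_coeff_dotProduct]
  refine Finset.sum_congr rfl fun t _ => finsum_congr fun r => ?_
  rw [F.coords_coeff, X.coeff_point_point F F', mul_comm]

/-- A generalized inverse `inv` of the boundary operator `C_k → C_j`, with an adjoint `adj` on the
opposite complex, such that `∂ ∘ inv` does not increase the filtration level. -/
structure GeneralizedInverse (j k : ℤ) where
  inv : X.chains K → X.chains K
  adj : X.toFloerNovikovData.op.chains K → X.toFloerNovikovData.op.chains K
  inv_mem : ∀ c, inv c ∈ X.graded K k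
  adj_mem : ∀ d, adj d ∈ X.toFloerNovikovData.op.graded K (-j)
  pairing_adj : ∀ d, ∀ c ∈ X.graded K j, X.pairing K (adj d) c = X.pairing K d (inv c)
  bd_inv_bd : ∀ c ∈ X.graded K k, X.bd (inv (X.bd c)) = X.bd c
  bd_inv_mem_filtLE : ∀ c ∈ X.graded K j, ∀ C, c ∈ X.filtLE K C → X.bd (inv c) ∈ X.filtLE K C

theorem nonempty_generalizedInverse (hinj : Set.InjOn X.period {g | X.deg g = 0}) {j k : ℤ}
    (hjk : k - 1 = j) : Nonempty (X.GeneralizedInverse j k) := by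
  classical
  obtain ⟨σ, hper, hadd, hdeg⟩ := X.exists_section_period hinj
  obtain ⟨F⟩ := X.nonempty_frame hper hadd hdeg k
  obtain ⟨F'⟩ := X.nonempty_frame hper hadd hdeg j
  have := X.finite_base
  have := Fintype.ofFinite S
  obtain ⟨h, hMhM, hMh⟩ := exists_comp_comp_eq_self_isNonexpanding (novikovVal X.periodGroup K)
    (fun t => ((-F'.height t : ℝ) : WithTop ℝ)) (X.bdMatrix F F').mulVecLin
  choose inv hinv_mem hinv using fun c : X.chains K =>
    F.exists_mem_graded_coords_eq (h (F'.coords c))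
  choose adj hadj_mem hadj using fun d : X.toFloerNovikovData.op.chains K =>
    F'.op.exists_mem_graded_coords_eq (F.op.coords d ᵥ* LinearMap.toMatrix' h)
  have hcoords (c) : F'.coords (X.bd (inv c)) =
      ((X.bdMatrix F F').mulVecLin ∘ₗ h) (F'.coords c) := by
    rw [← X.bdMatrix_mulVec_coords F F' (hinv_mem c), hinv]
    rfl
  refine ⟨inv, adj, hinv_mem, hadj_mem, fun d c hc => ?_, fun c hc => ?_, fun c hc C hC => ?_⟩
  · rw [F'.pairing_eq _ hc, F.pairing_eq _ (hinv_mem c), hadj, hinv, ← Matrix.dotProduct_mulVec,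
      LinearMap.toMatrix'_mulVec]
  · refine F'.coords_injOn (X.bd_mem_graded hjk (hinv_mem _)) (X.bd_mem_graded hjk hc) ?_
    rw [hcoords, ← X.bdMatrix_mulVec_coords F F' hc]
    exact LinearMap.congr_fun hMhM (F.coords c)
  · rw [F'.mem_filtLE_iff (X.bd_mem_graded hjk (hinv_mem c)), hcoords]
    exact hMh (F'.coords c) _ ((F'.mem_filtLE_iff hc).mp hC)

end BoundaryMatrix

theorem exists_delta_eq (hinj : Set.InjOn X.period {g | X.deg g = 0}) (α : ℝ) (k : ℤ)
    {d : X.toFloerNovikovData.op.chains K} (hd : d ∈ X.toFloerNovikovData.op.graded K (-k))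
    (hann : ∀ c ∈ X.graded K k, X.bd c ∈ X.filtLE K α → X.pairing K d c = 0) :
    ∃ e ∈ X.toFloerNovikovData.op.graded K (-k + 1),
      e ∈ X.toFloerNovikovData.op.filtLT K (-α) ∧ X.delta e = d := by
  obtain ⟨I⟩ := X.nonempty_generalizedInverse hinj (Eq.refl (k - 1))
  have hdeg : -(k - 1) = -k + 1 := by ring
  have hδ := X.delta_mem_graded rfl (I.adj_mem d)
  refine ⟨I.adj d, hdeg ▸ I.adj_mem d, ?_, X.op_graded_ext hδ hd fun c hc => ?_⟩
  · refine (X.mem_op_filtLT_iff_forall_pairing_eq_zero (I.adj_mem d)).mpr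
      fun c hc hcα => ?_
    rw [I.pairing_adj d c hc]
    exact hann _ (I.inv_mem c) (I.bd_inv_mem_filtLE c hc α hcα)
  · have hcycle : X.bd (I.inv (X.bd c) - c) = 0 := by rw [map_sub, I.bd_inv_bd c hc, sub_self]
    rw [X.pairing_delta, I.pairing_adj d _ (X.bd_graded k c hc), ← sub_eq_zero, ← map_sub]
    exact hann _ (sub_mem (I.inv_mem _) hc) (hcycle ▸ zero_mem _)

theorem exists_sub_bd_mem_filtLE (hinj : Set.InjOn X.period {g | X.deg g = 0}) (α : ℝ) (k : ℤ)
    {c : X.chains K} (hc : c ∈ X.graded K k)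
    (hann : ∀ d ∈ X.toFloerNovikovData.op.graded K (-k),
      d ∈ X.toFloerNovikovData.op.filtLT K (-α) → X.delta d = 0 → X.pairing K d c = 0) :
    ∃ e ∈ X.graded K (k + 1), c - X.bd e ∈ X.filtLE K α := by
  have hk : k + 1 - 1 = k := add_sub_cancel_right k 1
  obtain ⟨I⟩ := X.nonempty_generalizedInverse hinj hk
  refine ⟨I.inv c, I.inv_mem c, (X.mem_filtLE_iff_forall_pairing_eq_zero
    (sub_mem hc (X.bd_mem_graded hk (I.inv_mem c)))).mpr fun d hd hdα => ?_⟩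
  have hpair (b) (hb : b ∈ X.graded K k) :
      X.pairing K (d - I.adj (X.delta d)) b = X.pairing K d (b - X.bd (I.inv b)) := by
    rw [map_sub, map_sub, LinearMap.sub_apply, I.pairing_adj _ b hb, X.pairing_delta]
  have hd' : d - I.adj (X.delta d) ∈ X.toFloerNovikovData.op.graded K (-k) :=
    sub_mem hd (I.adj_mem _)
  rw [← hpair c hc]
  refine hann _ hd' ?_ ?_
  · refine (X.mem_op_filtLT_iff_forall_pairing_eq_zero hd').mpr fun b hb hbα => ?_
    rw [hpair b hb]
    exact X.pairing_filt α hdα (sub_mem hbα (I.bd_inv_mem_filtLE b hb α hbα))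
  · refine X.op_graded_ext (X.delta_mem_graded hk hd') (zero_mem _) fun b hb => ?_
    rw [X.pairing_delta, hpair _ (X.bd_mem_graded hk hb), I.bd_inv_bd b hb, sub_self, map_zero,
      map_zero]
    rfl

end FloerNovikovComplex

theorem mainTheorem1 {K Γ P S : Type*} [Field K] [CommGroup Γ]
    (X : FloerNovikovComplex K Γ P S)
    (hinj : Set.InjOn X.period {g | X.deg g = 0})
    (α : ℝ) (k : ℤ) :
    (X.homologyPairing α k).Nondegenerate := by
  constructor
  · intro b hb
    obtain ⟨⟨d, hdk, hd0⟩, rfl⟩ := Submodule.mkQ_surjective _ b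
    obtain ⟨e, hek, heα, he⟩ := X.exists_delta_eq hinj α k (d := d.1) hdk fun c hc hbc =>
      hb (gradedClass (X.gradedGT α) (X.bdGT α) k ⟨X.projGT α c, ⟨c, hc, rfl⟩,
        (Submodule.Quotient.mk_eq_zero _).mpr hbc⟩)
    refine (Submodule.Quotient.mk_eq_zero _).mpr ?_
    exact ⟨⟨e, heα⟩, hek, Subtype.ext he⟩
  · intro a ha
    obtain ⟨⟨_, ⟨c, hc, rfl⟩, hc0⟩, rfl⟩ := Submodule.mkQ_surjective _ a
    obtain ⟨e, hek, he⟩ := X.exists_sub_bd_mem_filtLE hinj α k hc fun d hdk hdα hd =>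
      ha (gradedClass (X.op.gradedLT (-α)) (X.op.bdLT (-α)) (-k) ⟨⟨d, hdα⟩, hdk, Subtype.ext hd⟩)
    refine (Submodule.Quotient.mk_eq_zero _).mpr ?_
    exact ⟨X.projGT α e, ⟨e, hek, rfl⟩, ((Submodule.Quotient.eq _).mpr he).symm⟩
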